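/- Let $X_\alpha=N\rtimes_\alpha\mathbb{R}$ be a purely real Heintze group with $N$ non-trivial: $N$ is a connected, simply connected, nilpotent real Lie group with Lie algebra $\mathfrak{n}\neq 0$, $\alpha$ is a derivation of $\mathfrak{n}$ all of whose eigenvalues are real and positive, and the semidirect product is defined by the action $\tau:\mathbb{R}\to\mathrm{Aut}(N)$ with $d_e\tau(t)=e^{t\alpha}$ for all $t\in\mathbb{R}$. Let $\varrho$ be a parabolic visual quasi-metric on $N$, that is, a function $\varrho:N\times N\to[0,\infty)$ such that - $\varrho$ is a quasi-metric: $\varrho(x,y)=0$ if and only if $x=y$, $\varrho(x,y)=\varrho(y,x)$, and for some $K\ge 1$ one has $\varrho(x,z)\le K(\varrho(x,y)+\varrho(y,z))$ for all $x,y,z\in N$; - $\varrho$ is continuous; - $\varrho$ is left invariant: $\varrho(gx,gy)=\varrho(x,y)$ for all $g,x,y\in N$; - $\varrho(\tau(t)x,\tau(t)y)=e^{t}\varrho(x,y)$ for all $t\in\mathbb{R}$ and $x,y\in N$. For $A\subset N$ let $\mathrm{Hdim}_\varrho(A)$ be the Hausdorff dimension of $A$ with respect to $\varrho$, defined through Hausdorff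 measures exactly as in a metric space, and let $$d_0(\varrho)=\inf\{\mathrm{Hdim}_\varrho(A): A\subset N \text{ is connected and has at least two points}\}.$$ Then $d_0(\varrho)=\lambda_1$, where $\lambda_1>0$ is the smallest eigenvalue of $\alpha$. -/

import Mathlib

open scoped Manifold ContDiff ENNReal NNReal

noncomputable section

/-! ### Real Lie groups and their Lie algebras -/

/-- A smooth real Lie group is regular enough to carry its Lie algebra. -/
instance leInftyMinSmoothnessReal : ENat.LEInfty (minSmoothness ℝ 3) := by
  rw [minSmoothness_of_isRCLikeNormedField]
  infer_instance

instance finiteDimensionalGroupLieAlgebra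
    {E : Type*} [NormedAddCommGroup E] [NormedSpace ℝ E] [FiniteDimensional ℝ E]
    {N : Type*} [TopologicalSpace N] [ChartedSpace E N] [Group N] :
    FiniteDimensional ℝ (GroupLieAlgebra 𝓘(ℝ, E) N) :=
  inferInstanceAs (FiniteDimensional ℝ E)

/-! ### The data of a purely real Heintze group -/

section Heintze

variable {E : Type*} [NormedAddCommGroup E] [NormedSpace ℝ E] [FiniteDimensional ℝ E]
  {N : Type*} [TopologicalSpace N] [ChartedSpace E N] [Group N] [LieGroup 𝓘(ℝ, E) ∞ N]

/-- The exponential `e ^ A` of an endomorphism of the Lie algebra of `N`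
(as a vector space, the Lie algebra is the model space `E`). -/
def lieAlgebraExp (A : GroupLieAlgebra 𝓘(ℝ, E) N →ₗ[ℝ] GroupLieAlgebra 𝓘(ℝ, E) N) :
    E →L[ℝ] E :=
  NormedSpace.exp (LinearMap.toContinuousLinearMap (show E →ₗ[ℝ] E from A))

/-- All the complex eigenvalues of the derivation are real (its characteristic polynomial splits
over the reals) and positive. -/
structure IsPurelyRealHeintze
    (α : LieDerivation ℝ (GroupLieAlgebra 𝓘(ℝ, E) N) (GroupLieAlgebra 𝓘(ℝ, E) N)) : Prop where
  splits : α.toLinearMap.charpoly.Splits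
  pos : ∀ μ : ℝ, Module.End.HasEigenvalue α.toLinearMap μ → 0 < μ

/-- `τ : ℝ → Aut(N)` is the action of `ℝ` on `N` by smooth automorphisms with `d_e τ(t) = e ^ (t α)`.
It is the action that defines the semidirect product `N ⋊_α ℝ`. -/
structure IsActionGeneratedBy (τ : Multiplicative ℝ →* MulAut N)
    (α : LieDerivation ℝ (GroupLieAlgebra 𝓘(ℝ, E) N) (GroupLieAlgebra 𝓘(ℝ, E) N)) : Prop where
  smooth : ∀ t : ℝ, ContMDiff 𝓘(ℝ, E) 𝓘(ℝ, E) ∞ (fun x : N => τ (Multiplicative.ofAdd t) x)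
  mfderiv_one : ∀ t : ℝ,
    (mfderiv 𝓘(ℝ, E) 𝓘(ℝ, E) (fun x : N => τ (Multiplicative.ofAdd t) x) (1 : N) : E →L[ℝ] E) =
      lieAlgebraExp (t • α.toLinearMap)

end Heintze

/-! ### Quasi-metrics -/

/-- A quasi-metric: as a metric, with the triangle inequality up to a multiplicative constant. -/
structure IsQuasiMetric {M : Type*} (ϱ : M → M → ℝ) : Prop where
  nonneg : ∀ x y, 0 ≤ ϱ x y
  eq_zero_iff : ∀ x y, ϱ x y = 0 ↔ x = y
  symm : ∀ x y, ϱ x y = ϱ y x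
  quasi_triangle : ∃ K : ℝ, 1 ≤ K ∧ ∀ x y z, ϱ x z ≤ K * (ϱ x y + ϱ y z)

/-- Parabolic visual quasi-metrics on `N` for the action `τ`: continuous left-invariant
quasi-metrics with `τ(t)^* ϱ = e ^ t ϱ`. -/
structure IsParabolicVisual {N : Type*} [TopologicalSpace N] [Group N]
    (τ : Multiplicative ℝ →* MulAut N) (ϱ : N → N → ℝ) : Prop extends IsQuasiMetric ϱ where
  continuous : Continuous (fun p : N × N => ϱ p.1 p.2)
  left_invariant : ∀ g x y, ϱ (g * x) (g * y) = ϱ x y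
  scaling : ∀ (t : ℝ) (x y : N),
    ϱ (τ (Multiplicative.ofAdd t) x) (τ (Multiplicative.ofAdd t) y) = Real.exp t * ϱ x y

/-! ### Hausdorff measure and dimension of a quasi-metric -/

section Hausdorff

variable {M : Type*}

/-- Diameter of a set. -/
def qDiam (ϱ : M → M → ℝ) (U : Set M) : ℝ≥0∞ :=
  ⨆ x ∈ U, ⨆ y ∈ U, ENNReal.ofReal (ϱ x y)

/-- The `t`-dimensional Hausdorff measure: the limit for `δ → 0` of the infimum of
`∑ diam(U i) ^ t` over the countable covers of `A` by sets of diameter at most `δ`.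
Empty sets contribute `0`, also for `t = 0`. -/
def qHausdorffMeasure (ϱ : M → M → ℝ) (t : ℝ≥0) (A : Set M) : ℝ≥0∞ :=
  ⨆ (δ : ℝ≥0∞) (_ : 0 < δ),
    ⨅ (U : ℕ → Set M) (_ : A ⊆ ⋃ i, U i) (_ : ∀ i, qDiam ϱ (U i) ≤ δ),
      ∑' i, ⨆ _ : (U i).Nonempty, qDiam ϱ (U i) ^ (t : ℝ)

/-- The Hausdorff dimension. -/
def qHdim (ϱ : M → M → ℝ) (A : Set M) : ℝ≥0∞ :=
  ⨆ (t : ℝ≥0) (_ : qHausdorffMeasure ϱ t A = ⊤), (t : ℝ≥0∞)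

/-- The infimum `d₀(ϱ)` of the Hausdorff dimensions of the non-degenerate (that is, with at least
two points) connected subsets. -/
def minConnectedHdim [TopologicalSpace M] (ϱ : M → M → ℝ) : ℝ≥0∞ :=
  ⨅ (A : Set M) (_ : IsConnected A) (_ : A.Nontrivial), qHdim ϱ A

end Hausdorff

end

/-! Upper bound: let `X` be an eigenvector of `α` for `lam` and `γ` a local one-parameter subgroup
with velocity `X`. Then `τ(t)` sends `γ b` to `γ (e^{t lam} b)`, while `ϱ` is multiplied by `e^t`.
Hence `ϱ 1 (γ w)` is a constant times `w ^ (1/lam)`, and left invariance makes `γ` a `1/lam`-Hölder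
arc, whose dimension is at most `lam` (`exists_isConnected_qHdim_le`).

Lower bound: let `t < s < lam`. Jordan blocks only contribute polynomial factors, so for some `t₀ >
0` the norm of `e^{-t₀ α}` is less than `e^{-t₀ s}`. Near the identity `τ(-t₀)` then shrinks the
chart norm by at least `q ^ s`, where `q = e^{-t₀}`, and shrinks `ϱ 1 ·` by exactly `q`. Comparing
scales gives `chartNorm ≤ C * ϱ ^ s` (`exists_chartNorm_le`). Truncating the chart norm yields a
locally `s`-Hölder function vanishing only at the identity (`exists_holder_function`). After a
translation it maps a non-degenerate connected set onto a set containing an interval, which forces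
infinite `t`-dimensional measure. -/

noncomputable section

/-! ### Exponential decay of linear flows. -/

open Filter Topology in
/-- The flow `exp (-t A)` decays faster than `exp (-t s)` on the generalized eigenspace of `μ > s`. -/
theorem tendsto_exp_neg_smul_apply_of_pow_apply_eq_zero {E : Type*} [NormedAddCommGroup E]
    [NormedSpace ℝ E] [CompleteSpace E] (A : E →L[ℝ] E) {s μ : ℝ} (hμ : s < μ) {k : ℕ} {v : E}
    (hv : ((A - μ • (1 : E →L[ℝ] E)) ^ k) v = 0) :
    Tendsto (fun t : ℝ => Real.exp (t * s) • NormedSpace.exp ((-t) • A) v) atTop (𝓝 0) := by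
  set B : E →L[ℝ] E := A - μ • (1 : E →L[ℝ] E) with hB
  have hBj : ∀ j, k ≤ j → (B ^ j) v = 0 := fun j hj => by
    obtain ⟨i, rfl⟩ := Nat.exists_eq_add_of_le' hj
    rw [pow_add, mul_apply_eq_comp, hv, map_zero]
  have key : ∀ t : ℝ, NormedSpace.exp ((-t) • A) v =
      Real.exp (-t * μ) • ∑ j ∈ Finset.range k, (((j.factorial : ℝ)⁻¹ * (-t) ^ j) • (B ^ j) v) := by
    intro t
    -- The scalar part commutes with `B`, and `B` is nilpotent on `v`, so `exp (-t B) v` is a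
    -- polynomial in `t`.
    have h1 : (-t) • A = algebraMap ℝ (E →L[ℝ] E) (-t * μ) + (-t) • B := by
      rw [hB, Algebra.algebraMap_eq_smul_one, smul_sub, smul_smul]; abel
    have h2 : NormedSpace.exp ((-t) • B) v =
        ∑ j ∈ Finset.range k, (((j.factorial : ℝ)⁻¹ * (-t) ^ j) • (B ^ j) v) := by
      have h3 := (NormedSpace.exp_series_hasSum_exp' (𝕂 := ℝ) ((-t) • B)).mapL
        (ContinuousLinearMap.apply ℝ E v)
      refine h3.unique ?_
      have h4 : (fun j : ℕ => ContinuousLinearMap.apply ℝ E v ((j.factorial : ℝ)⁻¹ • ((-t) • B) ^ j)) =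
          fun j : ℕ => (((j.factorial : ℝ)⁻¹ * (-t) ^ j) • (B ^ j) v) := by
        funext j
        rw [ContinuousLinearMap.apply_apply, smul_apply, smul_pow, smul_apply, smul_smul]
      rw [h4]
      exact hasSum_sum_of_ne_finset_zero fun j hj => by
        rw [hBj j (by simpa using hj), smul_zero]
    let _ : NormedAlgebra ℚ (E →L[ℝ] E) := NormedAlgebra.restrictScalars ℚ ℝ _
    rw [h1, NormedSpace.exp_add_of_commute (Algebra.commutes _ _),
      ← NormedSpace.algebraMap_exp_comm, ← Real.exp_eq_exp_ℝ, Algebra.algebraMap_eq_smul_one,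
      smul_mul_assoc, one_mul, smul_apply, h2]
  have : (fun t : ℝ => Real.exp (t * s) • NormedSpace.exp ((-t) • A) v) =
      fun t => ∑ j ∈ Finset.range k, (t ^ j * Real.exp (-(μ - s) * t)) •
        (((j.factorial : ℝ)⁻¹ * (-1) ^ j) • (B ^ j) v) := by
    funext t
    rw [key, smul_smul, ← Real.exp_add, Finset.smul_sum]
    refine Finset.sum_congr rfl fun j _ => ?_
    rw [smul_smul, smul_smul, neg_pow t]
    congr 1
    rw [show t * s + -t * μ = -(μ - s) * t by ring]; ring
  rw [this, ← Finset.sum_const_zero (s := Finset.range k)]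
  refine tendsto_finsetSum _ fun j _ => ?_
  have h5 := tendsto_rpow_mul_exp_neg_mul_atTop_nhds_zero (j : ℝ) (μ - s) (by linarith)
  simp only [Real.rpow_natCast] at h5
  simpa using h5.smul_const (((j.factorial : ℝ)⁻¹ * (-1) ^ j) • (B ^ j) v)

/-- The kernel of a product of powers of distinct linear factors is spanned by generalized
eigenvectors. -/
theorem ker_aeval_prod_sub_C_pow_le {K V : Type*} [Field K] [AddCommGroup V] [Module K V]
    (f : Module.End K V) (S : Finset K) (m : K → ℕ) (P : Submodule K V)
    (hP : ∀ μ ∈ S, LinearMap.ker (Polynomial.aeval f ((Polynomial.X - Polynomial.C μ) ^ m μ)) ≤ P) :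
    LinearMap.ker (Polynomial.aeval f
      (∏ μ ∈ S, (Polynomial.X - Polynomial.C μ) ^ m μ)) ≤ P := by
  classical
  induction S using Finset.induction_on with
  | empty =>
    intro v hv
    have : v = 0 := by simpa using hv
    simp [this]
  | insert a S ha ih =>
    rw [Finset.prod_insert ha, ← Polynomial.sup_ker_aeval_eq_ker_aeval_mul_of_coprime]
    · exact sup_le (hP a (Finset.mem_insert_self _ _))
        (ih fun μ hμ => hP μ (Finset.mem_insert_of_mem hμ))
    · refine IsCoprime.prod_right fun i hi => (IsCoprime.pow ?_)
      exact Polynomial.isCoprime_X_sub_C_of_isUnit_sub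
        (sub_ne_zero.2 (show a ≠ i by rintro rfl; exact ha hi)).isUnit

-- The vectors with this decay form a subspace containing every generalized eigenvector. Since the
-- characteristic polynomial splits and annihilates `A` (Cayley–Hamilton), this subspace is
-- everything.
open Filter Topology in
theorem tendsto_exp_neg_smul_apply {E : Type*} [NormedAddCommGroup E]
    [NormedSpace ℝ E] [FiniteDimensional ℝ E] (A : E →L[ℝ] E) {s : ℝ}
    (hsplit : (A : E →ₗ[ℝ] E).charpoly.Splits)
    (hs : ∀ μ : ℝ, Module.End.HasEigenvalue (A : E →ₗ[ℝ] E) μ → s < μ) (v : E) :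
    Tendsto (fun t : ℝ => Real.exp (t * s) • NormedSpace.exp ((-t) • A) v) atTop (𝓝 0) := by
  classical
  have : CompleteSpace E := FiniteDimensional.complete ℝ E
  let P : Submodule ℝ E :=
    { carrier := {v | Tendsto (fun t : ℝ => Real.exp (t * s) • NormedSpace.exp ((-t) • A) v)
        atTop (𝓝 0)}
      add_mem' := fun {a b} ha hb => by
        simpa [smul_add] using Tendsto.add (show Tendsto _ _ _ from ha) (show Tendsto _ _ _ from hb)
      zero_mem' := by simp
      smul_mem' := fun c x hx => by
        have := Tendsto.const_smul (show Tendsto _ _ _ from hx) c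
        simpa [smul_comm c] using this }
  set p := (A : E →ₗ[ℝ] E).charpoly with hp
  have hmonic : p.Monic := LinearMap.charpoly_monic _
  have hfac : p = ∏ μ ∈ p.roots.toFinset,
      (Polynomial.X - Polynomial.C μ) ^ p.rootMultiplicity μ := by
    rw [← Polynomial.prod_multiset_root_eq_finset_root]
    exact hsplit.eq_prod_roots_of_monic hmonic
  have hker := ker_aeval_prod_sub_C_pow_le (A : E →ₗ[ℝ] E) p.roots.toFinset
    (fun μ => p.rootMultiplicity μ) P (by
      intro μ hμ w hw
      have hroot : p.IsRoot μ := Polynomial.isRoot_of_mem_roots (Multiset.mem_toFinset.1 hμ)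
      have hev : Module.End.HasEigenvalue (A : E →ₗ[ℝ] E) μ :=
        (Module.End.hasEigenvalue_iff_isRoot_charpoly _ _).2 hroot
      refine tendsto_exp_neg_smul_apply_of_pow_apply_eq_zero A (hs μ hev)
        (k := p.rootMultiplicity μ) ?_
      rw [LinearMap.mem_ker] at hw
      rw [← hw]
      simp only [map_pow, map_sub, Polynomial.aeval_X, Polynomial.aeval_C]
      generalize p.rootMultiplicity μ = k
      clear hw
      induction k generalizing w with
      | zero => simp
      | succ k ih =>
        rw [pow_succ, pow_succ, Module.End.mul_apply, mul_apply_eq_comp, ih]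
        simp)
  rw [← hfac] at hker
  exact hker (by rw [hp, LinearMap.aeval_self_charpoly]; simp)

open Filter Topology in
/-- If `s` is smaller than all eigenvalues of `A`, then `‖exp (-t A)‖ < exp (-t s)` for some
`t > 0`. -/
theorem exists_norm_exp_neg_smul_lt {E : Type*} [NormedAddCommGroup E]
    [NormedSpace ℝ E] [FiniteDimensional ℝ E] (A : E →L[ℝ] E) {s : ℝ}
    (hsplit : (A : E →ₗ[ℝ] E).charpoly.Splits)
    (hs : ∀ μ : ℝ, Module.End.HasEigenvalue (A : E →ₗ[ℝ] E) μ → s < μ) :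
    ∃ t : ℝ, 0 < t ∧ ‖NormedSpace.exp ((-t) • A)‖ < Real.exp (-t * s) := by
  let b := Module.finBasis ℝ E
  obtain ⟨C, hC, hb⟩ := b.exists_opNorm_le (F := E)
  -- Smallness on a basis controls the operator norm up to the factor `C`; the threshold `1 / (2 *
  -- C)` makes the resulting bound `1/2`.
  have hev : ∀ᶠ t : ℝ in atTop, ∀ i,
      ‖Real.exp (t * s) • NormedSpace.exp ((-t) • A) (b i)‖ < 1 / (2 * C) := by
    rw [eventually_all]
    intro i
    have := (tendsto_exp_neg_smul_apply A hsplit hs (b i)).norm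
    rw [norm_zero] at this
    exact this.eventually_lt_const (by positivity)
  obtain ⟨t, ht, ht0⟩ := (hev.and (eventually_gt_atTop 0)).exists
  refine ⟨t, ht0, ?_⟩
  have h1 := hb (u := Real.exp (t * s) • NormedSpace.exp ((-t) • A)) (M := 1 / (2 * C))
    (by positivity) (fun i => (ht i).le)
  have h2 : C * (1 / (2 * C)) < 1 := by field_simp; norm_num
  rw [norm_smul, Real.norm_of_nonneg (Real.exp_pos _).le] at h1
  have h3 := Real.exp_pos (t * s)
  rw [neg_mul, Real.exp_neg, ← one_div, lt_div_iff₀ h3, mul_comm]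
  exact h1.trans_lt h2

end

/-! ### Hausdorff measure and Hölder maps. -/

noncomputable section

section HausdorffBounds

variable {M : Type*} {ϱ : M → M → ℝ}

theorem ofReal_le_qDiam {U : Set M} {x y : M} (hx : x ∈ U) (hy : y ∈ U) :
    ENNReal.ofReal (ϱ x y) ≤ qDiam ϱ U :=
  le_iSup₂_of_le x hx (le_iSup₂_of_le y hy le_rfl)

theorem qDiam_le {U : Set M} {d : ℝ≥0∞} (h : ∀ x ∈ U, ∀ y ∈ U, ENNReal.ofReal (ϱ x y) ≤ d) :
    qDiam ϱ U ≤ d :=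
  iSup₂_le fun x hx => iSup₂_le fun y hy => h x hx y hy

open MeasureTheory in
/-- A set with a non-null image under a locally `s`-Hölder real function has infinite
`t`-dimensional measure for all `t < s`. -/
theorem qHausdorffMeasure_eq_top_of_holder {A : Set M} {f : M → ℝ} {C δ₀ s : ℝ} {t : ℝ≥0}
    (hδ₀ : 0 < δ₀) (hC : 0 < C) (hts : t < s)
    (hf : ∀ x y, ϱ x y < δ₀ → |f x - f y| ≤ C * ϱ x y ^ s) (h0 : ∀ x y, 0 ≤ ϱ x y)
    (hvol : volume (f '' A) ≠ 0) : qHausdorffMeasure ϱ t A = ⊤ := by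
  have ht0 : (0 : ℝ) ≤ t := t.2
  have hs0 : 0 ≤ s := ht0.trans hts.le
  have hst : 0 < s - t := sub_pos.2 hts
  -- For a cover by sets of diameter at most `δ`, the image has volume at most `∑ C * diam ^ s ≤ C *
  -- δ ^ (s - t) * ∑ diam ^ t`.
  have key : ∀ δ : ℝ, 0 < δ → δ < δ₀ →
      volume (f '' A) ≤ ENNReal.ofReal (C * δ ^ (s - t)) * qHausdorffMeasure ϱ t A := by
    intro δ hδ hδ'
    have hc : ENNReal.ofReal (C * δ ^ (s - t)) ≠ 0 := by
      rw [ENNReal.ofReal_ne_zero_iff]; positivity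
    rw [← ENNReal.div_le_iff' hc ENNReal.ofReal_ne_top]
    refine le_iSup₂_of_le (ENNReal.ofReal δ) (by simpa using hδ) ?_
    refine le_iInf fun U => le_iInf fun hU => le_iInf fun hd => ?_
    rw [ENNReal.div_le_iff' hc ENNReal.ofReal_ne_top,
      ← ENNReal.tsum_mul_left]
    have hsub : f '' A ⊆ ⋃ i, f '' U i := by
      rw [← Set.image_iUnion]; exact Set.image_mono hU
    refine (measure_mono hsub).trans ((measure_iUnion_le _).trans (ENNReal.tsum_le_tsum fun i => ?_))
    rcases (U i).eq_empty_or_nonempty with he | hne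
    · simp [he]
    · refine (Real.volume_le_diam _).trans ?_
      rw [iSup_pos hne]
      have h1 : Metric.ediam (f '' U i) ≤ ENNReal.ofReal C * qDiam ϱ (U i) ^ s := by
        refine Metric.ediam_le ?_
        rintro _ ⟨x, hx, rfl⟩ _ ⟨y, hy, rfl⟩
        have h2 := ofReal_le_qDiam (ϱ := ϱ) hx hy
        have h3 : ϱ x y < δ₀ :=
          ((ENNReal.ofReal_le_ofReal_iff hδ.le).1 (h2.trans (hd i))).trans_lt hδ'
        rw [edist_dist, Real.dist_eq]
        refine (ENNReal.ofReal_le_ofReal (hf x y h3)).trans ?_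
        rw [ENNReal.ofReal_mul hC.le, ← ENNReal.ofReal_rpow_of_nonneg (h0 x y) hs0]
        gcongr
      refine h1.trans ?_
      rw [ENNReal.ofReal_mul hC.le, ← ENNReal.ofReal_rpow_of_nonneg hδ.le hst.le, mul_assoc]
      gcongr
      calc qDiam ϱ (U i) ^ s = qDiam ϱ (U i) ^ (s - t) * qDiam ϱ (U i) ^ (t : ℝ) := by
            rw [← ENNReal.rpow_add_of_nonneg _ _ hst.le ht0, sub_add_cancel]
        _ ≤ _ := by gcongr; exact hd i
  -- If the measure were finite, letting `δ → 0` would make the image null.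
  by_contra hne
  have hlim : Filter.Tendsto
      (fun δ : ℝ => ENNReal.ofReal (C * δ ^ (s - t)) * qHausdorffMeasure ϱ t A)
      (nhdsWithin 0 (Set.Ioi 0)) (nhds 0) := by
    have h1 : Filter.Tendsto (fun δ : ℝ => C * δ ^ (s - t)) (nhdsWithin 0 (Set.Ioi 0)) (nhds 0) := by
      have := ((Real.continuousAt_rpow_const 0 (s - t) (Or.inr hst.le)).tendsto.const_mul C).mono_left
        (nhdsWithin_le_nhds (s := Set.Ioi 0))
      simpa [Real.zero_rpow hst.ne'] using this
    have h2 := ENNReal.Tendsto.mul_const (b := qHausdorffMeasure ϱ t A) (ENNReal.tendsto_ofReal h1)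
      (Or.inr hne)
    simpa using h2
  refine hvol (le_antisymm (ge_of_tendsto hlim ?_) bot_le)
  filter_upwards [Ioo_mem_nhdsGT hδ₀] with δ hδ
  exact key δ hδ.1 hδ.2

/-- The dimension of a `1/lam`-Hölder curve is at most `lam`. -/
theorem qHdim_image_Icc_le {γ : ℝ → M} {u C lam : ℝ} (hu : 0 < u) (hlam : 0 < lam) (hC : 0 ≤ C)
    (hγ : ∀ a ∈ Set.Icc 0 u, ∀ b ∈ Set.Icc 0 u, ϱ (γ a) (γ b) ≤ C * |a - b| ^ (1 / lam)) :
    qHdim ϱ (γ '' Set.Icc 0 u) ≤ ENNReal.ofReal lam := by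
  refine iSup₂_le fun t ht => ?_
  by_contra hlt
  rw [not_le] at hlt
  have htl : lam < t := by
    rw [← ENNReal.ofReal_coe_nnreal] at hlt
    exact (ENNReal.ofReal_lt_ofReal_iff_of_nonneg hlam.le).1 hlt
  refine (lt_top_iff_ne_top.1 (lt_of_le_of_lt ?_ (ENNReal.ofReal_lt_top
    (r := C ^ (t : ℝ) * u ^ (t / lam : ℝ))))) ht
  refine iSup₂_le fun δ hδ => ?_
  have hlim : Filter.Tendsto (fun n : ℕ => ENNReal.ofReal (C * (u / (n + 1 : ℕ)) ^ (1 / lam)))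
      Filter.atTop (nhds 0) := by
    have h1 : Filter.Tendsto (fun n : ℕ => u / ((n + 1 : ℕ) : ℝ)) Filter.atTop (nhds 0) :=
      (tendsto_const_div_atTop_nhds_zero_nat u).comp (Filter.tendsto_add_atTop_nat 1)
    have h2 := ((Real.continuousAt_rpow_const 0 (1 / lam) (Or.inr (by positivity))).tendsto.comp
      h1).const_mul C
    rw [Real.zero_rpow (by positivity), mul_zero] at h2
    simpa using ENNReal.tendsto_ofReal h2
  obtain ⟨n, hn⟩ := (hlim.eventually_le_const hδ).exists
  set k : ℕ := n + 1 with hk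
  have hkpos : (0 : ℝ) < k := by positivity
  set w : ℝ := u / k with hw
  have hwpos : 0 < w := by positivity
  -- Cutting the interval into `k` pieces of length `w = u / k` gives a sum of at most `k * (C * w ^
  -- (1/lam)) ^ t`, which stays bounded in `k` because `t / lam > 1`.
  let U : ℕ → Set M := fun i =>
    if i < k then γ '' (Set.Icc 0 u ∩ Set.Icc (i * w) ((i + 1) * w)) else ∅
  have hdiam : ∀ i, qDiam ϱ (U i) ≤ ENNReal.ofReal (C * w ^ (1 / lam)) := by
    intro i
    refine qDiam_le fun x hx y hy => ENNReal.ofReal_le_ofReal ?_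
    by_cases hi : i < k
    · simp only [U, hi, if_true] at hx hy
      obtain ⟨a, ha, rfl⟩ := hx
      obtain ⟨b, hb, rfl⟩ := hy
      refine (hγ a ha.1 b hb.1).trans ?_
      have : |a - b| ≤ w := by
        rw [abs_le]; constructor <;> linarith [ha.2.1, ha.2.2, hb.2.1, hb.2.2]
      gcongr
    · simp [U, hi] at hx
  refine iInf_le_of_le U (iInf_le_of_le ?_ (iInf_le_of_le (fun i => (hdiam i).trans hn) ?_))
  · rintro _ ⟨a, ha, rfl⟩
    rw [Set.mem_iUnion]
    -- At the right endpoint `⌊a / w⌋₊` would be `k`, out of range; that point is put in the last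
    -- piece, of index `n = k - 1`.
    rcases eq_or_lt_of_le ha.2 with rfl | hau
    · refine ⟨n, ?_⟩
      simp only [U, hk, Nat.lt_succ_self, if_true]
      refine ⟨a, ⟨ha, ?_, ?_⟩, rfl⟩
      · rw [hw, mul_div_assoc', div_le_iff₀ hkpos, hk, mul_comm]
        push_cast
        nlinarith
      · rw [hw, mul_div_assoc', le_div_iff₀ hkpos, hk, mul_comm]
        push_cast
        nlinarith
    · have h1 := Nat.floor_le (div_nonneg ha.1 hwpos.le)
      have h2 := Nat.lt_floor_add_one (a / w)
      have h3 : ⌊a / w⌋₊ < k := by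
        rw [Nat.floor_lt (div_nonneg ha.1 hwpos.le), div_lt_iff₀ hwpos, hw]
        field_simp
        exact hau
      refine ⟨⌊a / w⌋₊, ?_⟩
      simp only [U, h3, if_true]
      exact ⟨a, ⟨ha, (le_div_iff₀ hwpos).1 h1, ((div_lt_iff₀ hwpos).1 h2).le⟩, rfl⟩
  · have ht0 : (0 : ℝ) < t := hlam.trans htl
    calc ∑' i, ⨆ _ : (U i).Nonempty, qDiam ϱ (U i) ^ (t : ℝ)
        ≤ ∑' i, (if i < k then ENNReal.ofReal (C * w ^ (1 / lam)) ^ (t : ℝ) else 0) := by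
          refine ENNReal.tsum_le_tsum fun i => iSup_le fun hne => ?_
          by_cases hi : i < k
          · rw [if_pos hi]
            gcongr
            exact hdiam i
          · simp [U, hi] at hne
      _ = ∑ i ∈ Finset.range k, ENNReal.ofReal (C * w ^ (1 / lam)) ^ (t : ℝ) := by
          rw [tsum_eq_sum (s := Finset.range k) (fun i hi => if_neg (by simpa using hi))]
          exact Finset.sum_congr rfl fun i hi => if_pos (by simpa using hi)
      _ = ENNReal.ofReal (k * (C * w ^ (1 / lam)) ^ (t : ℝ)) := by
          rw [Finset.sum_const, Finset.card_range, nsmul_eq_mul,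
            ENNReal.ofReal_rpow_of_nonneg (by positivity) ht0.le, ENNReal.ofReal_mul hkpos.le,
            ENNReal.ofReal_natCast]
      _ ≤ _ := by
          refine ENNReal.ofReal_le_ofReal ?_
          rw [Real.mul_rpow hC (by positivity), ← Real.rpow_mul hwpos.le, hw,
            Real.div_rpow hu.le hkpos.le, show 1 / lam * (t : ℝ) = t / lam by ring]
          have h1 : (k : ℝ) ≤ (k : ℝ) ^ (t / lam : ℝ) := by
            conv_lhs => rw [← Real.rpow_one (k : ℝ)]
            refine Real.rpow_le_rpow_of_exponent_le ?_ ?_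
            · rw [hk]; push_cast; linarith [Nat.cast_nonneg (α := ℝ) n]
            · rw [le_div_iff₀ hlam]; linarith
          have h2 : (0 : ℝ) < (k : ℝ) ^ (t / lam : ℝ) := by positivity
          calc (k : ℝ) * (C ^ (t : ℝ) * (u ^ (t / lam : ℝ) / (k : ℝ) ^ (t / lam : ℝ)))
              = C ^ (t : ℝ) * u ^ (t / lam : ℝ) * (k / (k : ℝ) ^ (t / lam : ℝ)) := by ring
            _ ≤ C ^ (t : ℝ) * u ^ (t / lam : ℝ) * 1 := by
                gcongr
                rw [div_le_one h2]; exact h1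
            _ = _ := mul_one _

end HausdorffBounds
end

/-! ### Contracting maps and comparison of scales. -/

noncomputable section

open Filter Topology

/-- An endomorphism of a connected topological group that contracts a neighbourhood of `1`
contracts the whole group. -/
theorem tendsto_iterate_of_eventually {N : Type*} [TopologicalSpace N] [Group N]
    [IsTopologicalGroup N] [ConnectedSpace N] (T : N →* N)
    (h : ∀ᶠ g in 𝓝 (1 : N), Tendsto (fun n : ℕ => T^[n] g) atTop (𝓝 1)) (g : N) :
    Tendsto (fun n : ℕ => T^[n] g) atTop (𝓝 1) := by
  -- The contracted points form a subgroup; it contains a neighbourhood of `1`, so it is open, hence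
  -- closed, hence everything.
  let H : Subgroup N :=
    { carrier := {g | Tendsto (fun n : ℕ => T^[n] g) atTop (𝓝 1)}
      mul_mem' := fun {a b} ha hb => by
        simpa using Tendsto.mul (show Tendsto _ _ _ from ha) (show Tendsto _ _ _ from hb)
      one_mem' := by simpa using tendsto_const_nhds
      inv_mem' := fun {a} ha => by
        simpa using Tendsto.inv (show Tendsto _ _ _ from ha) }
  have hopen : IsOpen (H : Set N) := Subgroup.isOpen_of_mem_nhds H (g := 1) h
  have hclopen : IsClopen (H : Set N) := ⟨Subgroup.isClosed_of_isOpen H hopen, hopen⟩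
  have := hclopen.eq_univ ⟨1, H.one_mem⟩
  exact (this ▸ Set.mem_univ g : g ∈ (H : Set N))

/-- Sublevel sets of a continuous function that is decreased by a contracting homeomorphism and
vanishes only at the fixed point are small neighbourhoods of that point. -/
theorem exists_forall_le_imp_mem {N : Type*} [TopologicalSpace N] {o : N} (T : N ≃ₜ N)
    (hT : ∀ g, Tendsto (fun n : ℕ => T^[n] g) atTop (𝓝 o))
    {ρ : N → ℝ} (hρ : Continuous ρ) (hpos : ∀ g, g ≠ o → 0 < ρ g)
    (hTρ : ∀ g, ρ (T g) ≤ ρ g) {V C : Set N} (hV : IsOpen V) (hoV : o ∈ V) (hC : IsCompact C)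
    (hVC : V ⊆ C) : ∃ m > 0, ∀ g, ρ g ≤ m → g ∈ V := by
  -- An orbit starting outside `V` visits this compact shell just before it first enters `V`. As `ρ`
  -- does not increase along orbits, its minimum on the shell bounds it below off `V`.
  have hS : IsCompact (T ⁻¹' C \ V) := (T.isCompact_preimage.2 hC).diff hV
  have hiter : ∀ (n : ℕ) g, ρ (T^[n] g) ≤ ρ g := by
    intro n
    induction n with
    | zero => simp
    | succ n ih => intro g; rw [Function.iterate_succ_apply]; exact (ih _).trans (hTρ g)
  have hexit : ∀ g, g ∉ V → ∃ k ∈ T ⁻¹' C \ V, ρ k ≤ ρ g := by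
    classical
    intro g hg
    have hex : ∃ n : ℕ, T^[n] g ∈ V := ((hT g).eventually (hV.mem_nhds hoV)).exists
    obtain ⟨n, hn⟩ : ∃ n, Nat.find hex = n + 1 :=
      Nat.exists_eq_succ_of_ne_zero fun h0 => hg (by simpa [h0] using Nat.find_spec hex)
    refine ⟨T^[n] g, ⟨?_, Nat.find_min hex (by omega)⟩, hiter n g⟩
    have := Nat.find_spec hex
    rw [hn, Function.iterate_succ_apply'] at this
    exact hVC this
  rcases (T ⁻¹' C \ V).eq_empty_or_nonempty with he | hne
  · refine ⟨1, one_pos, fun g _ => ?_⟩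
    by_contra hg
    obtain ⟨k, hk, -⟩ := hexit g hg
    simp [he] at hk
  · obtain ⟨k₀, hk₀, hmin⟩ := hS.exists_isMinOn hne hρ.continuousOn
    have hk₀pos : 0 < ρ k₀ := hpos _ fun h => hk₀.2 (h ▸ hoV)
    refine ⟨ρ k₀ / 2, half_pos hk₀pos, fun g hg => ?_⟩
    by_contra hgV
    obtain ⟨k, hk, hkg⟩ := hexit g hgV
    have := isMinOn_iff.1 hmin k hk
    linarith

/-- If `T` multiplies `ρ` by `q` and `h` by at most `q ^ s`, then `h` is bounded by a multiple of
`ρ ^ s`. -/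
theorem exists_le_mul_rpow_of_contraction {N : Type*} (T : N ≃ N) {ρ h : N → ℝ}
    {q s m r : ℝ} (hq : 0 < q) (hq1 : q < 1) (hs : 0 < s) (hm : 0 < m) (hr : 0 < r)
    (hρ0 : ∀ g, 0 ≤ ρ g) (hTρ : ∀ g, ρ (T g) = q * ρ g)
    (hzero : ∀ g, ρ g = 0 → h g = 0) (hr' : ∀ g, ρ g ≤ m → h g ≤ r)
    (hTh : ∀ g, ρ g ≤ m → h (T g) ≤ q ^ s * h g) :
    ∃ C > 0, ∀ g, ρ g ≤ m → h g ≤ C * ρ g ^ s := by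
  refine ⟨r * (q ^ s)⁻¹ * (m ^ s)⁻¹, by positivity, fun g hg => ?_⟩
  rcases (hρ0 g).eq_or_lt with h0 | hpos
  · rw [hzero g h0.symm, ← h0, Real.zero_rpow hs.ne', mul_zero]
  have hsymm : ∀ g, ρ (T.symm g) = q⁻¹ * ρ g := fun g => by
    have := hTρ (T.symm g)
    rw [T.apply_symm_apply] at this
    rw [this]; field_simp
  have hiter : ∀ (n : ℕ) g, ρ g ≤ q ^ n * m → h g ≤ (q ^ s) ^ n * r := by
    intro n
    induction n with
    | zero => intro g hg; simpa using hr' g (by simpa using hg)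
    | succ n ih =>
      intro g hg
      have h1 : ρ (T.symm g) ≤ q ^ n * m := by
        rw [hsymm, inv_mul_le_iff₀ hq]
        calc ρ g ≤ _ := hg
          _ = _ := by ring
      have h2 : ρ (T.symm g) ≤ m :=
        h1.trans (mul_le_of_le_one_left hm.le (pow_le_one₀ hq.le hq1.le))
      have h3 := hTh _ h2
      rw [T.apply_symm_apply] at h3
      calc h g ≤ _ := h3
        _ ≤ q ^ s * ((q ^ s) ^ n * r) := by gcongr; exact ih _ h1
        _ = _ := by ring
  -- The scale of `g`: `q ^ (n + 1) * m < ρ g ≤ q ^ n * m`. The gap of one step costs the factor `(q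
  -- ^ s)⁻¹` in the constant.
  obtain ⟨n, hn1, hn2⟩ := exists_nat_pow_near_of_lt_one (div_pos hpos hm)
    ((div_le_one hm).2 hg) hq hq1
  refine (hiter n g ((div_le_iff₀ hm).1 hn2)).trans ?_
  have h4 : (q ^ s) ^ n = (q ^ s)⁻¹ * (q ^ (n + 1)) ^ s := by
    rw [← Real.rpow_natCast (q ^ s), ← Real.rpow_mul hq.le, ← Real.rpow_natCast q,
      ← Real.rpow_mul hq.le, ← Real.rpow_neg hq.le, ← Real.rpow_add hq]
    congr 1; push_cast; ring
  rw [h4]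
  calc (q ^ s)⁻¹ * (q ^ (n + 1)) ^ s * r ≤ (q ^ s)⁻¹ * (ρ g / m) ^ s * r := by gcongr
    _ = _ := by rw [Real.div_rpow hpos.le hm.le]; ring

end

/-! ### The chart at the identity. -/

noncomputable section

open Filter Topology

section Chart

variable {E : Type*} [NormedAddCommGroup E] [NormedSpace ℝ E]
  {N : Type*} [TopologicalSpace N] [ChartedSpace E N] [Group N]

/-- The distance to the identity in the preferred chart at the identity. -/
def chartNorm (E : Type*) [NormedAddCommGroup E] [NormedSpace ℝ E]
    {N : Type*} [TopologicalSpace N] [ChartedSpace E N] [Group N] (g : N) : ℝ :=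
  ‖extChartAt 𝓘(ℝ, E) (1 : N) g - extChartAt 𝓘(ℝ, E) (1 : N) 1‖

/-- The open ball around the identity in the preferred chart at the identity. -/
def chartBall (E : Type*) [NormedAddCommGroup E] [NormedSpace ℝ E]
    (N : Type*) [TopologicalSpace N] [ChartedSpace E N] [Group N] (r : ℝ) : Set N :=
  {g | g ∈ (extChartAt 𝓘(ℝ, E) (1 : N)).source ∧ chartNorm E g < r}

theorem chartNorm_one : chartNorm E (1 : N) = 0 := by simp [chartNorm]

theorem chartNorm_nonneg (g : N) : 0 ≤ chartNorm E g := norm_nonneg _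

theorem chartNorm_pos {g : N} (hg : g ∈ (extChartAt 𝓘(ℝ, E) (1 : N)).source) (h : g ≠ 1) :
    0 < chartNorm E g := by
  rw [chartNorm, norm_pos_iff, sub_ne_zero]
  exact fun he => h ((extChartAt 𝓘(ℝ, E) (1 : N)).injOn hg (mem_extChartAt_source _) he)

theorem one_mem_chartBall {r : ℝ} (hr : 0 < r) : (1 : N) ∈ chartBall E N r :=
  ⟨mem_extChartAt_source _, by rwa [chartNorm_one]⟩

theorem chartBall_mono {r r' : ℝ} (h : r ≤ r') : chartBall E N r ⊆ chartBall E N r' :=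
  fun _ hg => ⟨hg.1, hg.2.trans_le h⟩

theorem isOpen_chartBall (r : ℝ) : IsOpen (chartBall E N r) := by
  have h := (continuousOn_extChartAt (I := 𝓘(ℝ, E)) (1 : N)).isOpen_inter_preimage
    (isOpen_extChartAt_source (I := 𝓘(ℝ, E)) (1 : N))
    (Metric.isOpen_ball (x := extChartAt 𝓘(ℝ, E) (1 : N) 1) (ε := r))
  convert h using 1
  ext g
  simp only [chartBall, chartNorm, Set.mem_ofPred_eq, Set.mem_inter_iff, Set.mem_preimage,
    mem_ball_iff_norm]

theorem exists_chartBall_subset {U : Set N} (hU : U ∈ 𝓝 (1 : N)) :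
    ∃ r > 0, chartBall E N r ⊆ U := by
  have h := (continuousAt_extChartAt_symm (I := 𝓘(ℝ, E)) (1 : N)).preimage_mem_nhds
    (by rwa [extChartAt_to_inv])
  obtain ⟨r, hr, hsub⟩ := Metric.mem_nhds_iff.1 h
  refine ⟨r, hr, fun g hg => ?_⟩
  have := hsub (mem_ball_iff_norm.2 hg.2)
  rwa [Set.mem_preimage, (extChartAt 𝓘(ℝ, E) (1 : N)).left_inv hg.1] at this

theorem exists_isCompact_chartBall_subset [FiniteDimensional ℝ E] :
    ∃ r > 0, ∃ C : Set N, IsCompact C ∧ chartBall E N r ⊆ C := by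
  obtain ⟨r, hr, hsub⟩ := Metric.nhds_basis_closedBall.mem_iff.1
    (extChartAt_target_mem_nhds (I := 𝓘(ℝ, E)) (1 : N))
  refine ⟨r, hr, (extChartAt 𝓘(ℝ, E) (1 : N)).symm '' Metric.closedBall _ r,
    (isCompact_closedBall _ _).image_of_continuousOn
      ((continuousOn_extChartAt_symm (1 : N)).mono hsub), fun g hg => ?_⟩
  exact ⟨extChartAt 𝓘(ℝ, E) (1 : N) g, mem_closedBall_iff_norm.2 hg.2.le,
    (extChartAt 𝓘(ℝ, E) (1 : N)).left_inv hg.1⟩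

/-- A homomorphism whose differential at the identity has norm less than `c` contracts
the chart norm by `c` near the identity. -/
theorem eventually_chartNorm_map_le (T : N →* N) (hT : ContMDiff 𝓘(ℝ, E) 𝓘(ℝ, E) ∞ T) {c : ℝ}
    {D : E →L[ℝ] E} (hD : (mfderiv 𝓘(ℝ, E) 𝓘(ℝ, E) T (1 : N) : E →L[ℝ] E) = D) (hc : ‖D‖ < c) :
    ∀ᶠ g in 𝓝 (1 : N), T g ∈ (extChartAt 𝓘(ℝ, E) (1 : N)).source ∧
      chartNorm E (T g) ≤ c * chartNorm E g := by
  set φ := extChartAt 𝓘(ℝ, E) (1 : N) with hφ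
  have hd : HasFDerivAt (φ ∘ T ∘ φ.symm) D (φ 1) := by
    have h1 : HasFDerivWithinAt (writtenInExtChartAt 𝓘(ℝ, E) 𝓘(ℝ, E) (1 : N) T) D
        (Set.range 𝓘(ℝ, E)) (φ 1) := by
      rw [← hD]
      exact ((hT.mdifferentiable (by simp)) (1 : N)).hasMFDerivAt.2
    have h2 : writtenInExtChartAt 𝓘(ℝ, E) 𝓘(ℝ, E) (1 : N) T = φ ∘ T ∘ φ.symm := by
      rw [writtenInExtChartAt, map_one]
    rw [h2, ModelWithCorners.range_eq_univ, hasFDerivWithinAt_univ] at h1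
    exact h1
  have h3 : ∀ᶠ v in 𝓝 (φ 1), ‖φ (T (φ.symm v)) - φ 1‖ ≤ c * ‖v - φ 1‖ := by
    filter_upwards [(Asymptotics.isLittleO_iff.1 hd.isLittleO) (sub_pos.2 hc)] with v hv
    have h4 : (φ ∘ T ∘ φ.symm) (φ 1) = φ 1 := by
      simp only [Function.comp_apply, hφ, extChartAt_to_inv, map_one]
    rw [h4] at hv
    have h5 := norm_le_norm_add_norm_sub' ((φ ∘ T ∘ φ.symm) v - φ 1) (D (v - φ 1))
    have h6 := D.le_opNorm (v - φ 1)
    simp only [Function.comp_apply] at *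
    nlinarith
  have hcont : ContinuousAt T 1 := hT.continuous.continuousAt
  filter_upwards [(continuousAt_extChartAt (I := 𝓘(ℝ, E)) (1 : N)).eventually h3,
    extChartAt_source_mem_nhds (I := 𝓘(ℝ, E)) (1 : N),
    hcont.preimage_mem_nhds (by
      rw [map_one]; exact extChartAt_source_mem_nhds (I := 𝓘(ℝ, E)) (1 : N))] with g h4 h5 h6
  refine ⟨h6, ?_⟩
  rw [← hφ, φ.left_inv h5] at h4
  exact h4

variable [LieGroup 𝓘(ℝ, E) ∞ N]

/-- The multiplication is locally Lipschitz in the chart at the identity. -/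
theorem exists_norm_chart_mul_sub_le :
    ∃ L > 0, ∃ U ∈ 𝓝 (1 : N), ∀ g ∈ U, ∀ k ∈ U, g * k ∈ (extChartAt 𝓘(ℝ, E) (1 : N)).source ∧
      ‖extChartAt 𝓘(ℝ, E) (1 : N) (g * k) - extChartAt 𝓘(ℝ, E) (1 : N) g‖ ≤ L * chartNorm E k := by
  have : IsTopologicalGroup N := topologicalGroup_of_lieGroup 𝓘(ℝ, E) ∞
  have : IsManifold 𝓘(ℝ, E) 1 N := IsManifold.of_le (n := ∞) (by simp)
  set φ := extChartAt 𝓘(ℝ, E) (1 : N) with hφ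
  have hsymm : ContMDiffAt 𝓘(ℝ, E) 𝓘(ℝ, E) 1 φ.symm (φ 1) :=
    (contMDiffOn_extChartAt_symm (1 : N)).contMDiffAt (extChartAt_target_mem_nhds (1 : N))
  have h1 : ContMDiffAt 𝓘(ℝ, E × E) 𝓘(ℝ, E) 1 (fun p : E × E => φ.symm p.1) (φ 1, φ 1) :=
    ContMDiffAt.comp (φ 1, φ 1) hsymm contDiff_fst.contMDiff.contMDiffAt
  have h2 : ContMDiffAt 𝓘(ℝ, E × E) 𝓘(ℝ, E) 1 (fun p : E × E => φ.symm p.2) (φ 1, φ 1) :=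
    ContMDiffAt.comp (φ 1, φ 1) hsymm contDiff_snd.contMDiff.contMDiffAt
  have : LieGroup 𝓘(ℝ, E) 1 N := LieGroup.of_le (n := ∞) (by simp)
  have h3 := h1.mul h2
  have h4 : ContMDiffAt 𝓘(ℝ, E × E) 𝓘(ℝ, E) 1
      (fun p : E × E => φ (φ.symm p.1 * φ.symm p.2)) (φ 1, φ 1) := by
    refine ContMDiffAt.comp (φ 1, φ 1) (g := φ) ?_ h3
    have : φ.symm (φ 1) * φ.symm (φ 1) = 1 := by rw [hφ, extChartAt_to_inv, one_mul]
    simp only [this]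
    exact contMDiffAt_extChartAt
  obtain ⟨K, s, hs, hlip⟩ := (contMDiffAt_iff_contDiffAt.1 h4).exists_lipschitzOnWith
  rw [nhds_prod_eq, mem_prod_same_iff] at hs
  obtain ⟨W, hW, hWs⟩ := hs
  have hmul : ∀ᶠ p : N × N in 𝓝 (1 : N) ×ˢ 𝓝 (1 : N), p.1 * p.2 ∈ φ.source := by
    rw [← nhds_prod_eq]
    refine continuous_mul.continuousAt.preimage_mem_nhds ?_
    rw [one_mul]
    exact extChartAt_source_mem_nhds _
  obtain ⟨W', hW', hW's⟩ := mem_prod_same_iff.1 hmul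
  -- `K` may vanish, whereas a positive constant is required.
  refine ⟨K + 1, by positivity, φ ⁻¹' W ∩ W' ∩ φ.source,
    inter_mem (inter_mem ((continuousAt_extChartAt _).preimage_mem_nhds hW) hW')
      (extChartAt_source_mem_nhds _), fun g hg k hk => ⟨hW's (Set.mk_mem_prod hg.1.2 hk.1.2), ?_⟩⟩
  -- Since `g = g * 1`, only the second factor varies, from `1` to `k`.
  have h5 := hlip.dist_le_mul (φ g, φ k) (hWs (Set.mk_mem_prod hg.1.1 hk.1.1)) (φ g, φ 1)
    (hWs (Set.mk_mem_prod hg.1.1 (mem_of_mem_nhds hW)))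
  have hone : φ.symm (φ 1) = 1 := extChartAt_to_inv _
  rw [dist_prod_same_left, dist_eq_norm, dist_eq_norm, φ.left_inv hg.2, φ.left_inv hk.2, hone,
    mul_one] at h5
  refine h5.trans ?_
  gcongr
  · simp
  · exact le_rfl

end Chart

end

/-! ### Lower bound: connected sets have dimension at least `lam`. -/

noncomputable section

open Filter Topology

section LowerBound

variable {E : Type*} [NormedAddCommGroup E] [NormedSpace ℝ E] [FiniteDimensional ℝ E]
  {N : Type*} [TopologicalSpace N] [ChartedSpace E N] [Group N]

theorem lieAlgebraExp_smul
    (A : GroupLieAlgebra 𝓘(ℝ, E) N →ₗ[ℝ] GroupLieAlgebra 𝓘(ℝ, E) N) (t : ℝ) :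
    lieAlgebraExp (t • A) =
      NormedSpace.exp (t • LinearMap.toContinuousLinearMap (show E →ₗ[ℝ] E from A)) := by
  rw [← map_smul]
  rfl

theorem IsParabolicVisual.rho_one_map {N : Type*} [TopologicalSpace N] [Group N]
    {τ : Multiplicative ℝ →* MulAut N} {ϱ : N → N → ℝ}
    (hϱ : IsParabolicVisual τ ϱ) (t : ℝ) (g : N) :
    ϱ 1 (τ (Multiplicative.ofAdd t) g) = Real.exp t * ϱ 1 g := by
  have := hϱ.scaling t 1 g
  rwa [map_one] at this

variable [LieGroup 𝓘(ℝ, E) ∞ N]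

/-- In the chart at the identity, the distance to the identity is bounded by a power of the
parabolic visual quasi-metric, with any exponent smaller than all eigenvalues of `α`. -/
theorem exists_chartNorm_le [ConnectedSpace N]
    (α : LieDerivation ℝ (GroupLieAlgebra 𝓘(ℝ, E) N) (GroupLieAlgebra 𝓘(ℝ, E) N))
    (hα : IsPurelyRealHeintze α)
    (τ : Multiplicative ℝ →* MulAut N) (hτ : IsActionGeneratedBy τ α)
    (ϱ : N → N → ℝ) (hϱ : IsParabolicVisual τ ϱ) {s : ℝ} (hs0 : 0 < s)
    (hs : ∀ μ : ℝ, Module.End.HasEigenvalue α.toLinearMap μ → s < μ) {U : Set N}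
    (hU : U ∈ 𝓝 (1 : N)) :
    ∃ r > 0, ∃ m > 0, ∃ C > 0, chartBall E N r ⊆ U ∧
      ∀ g : N, ϱ 1 g ≤ m → g ∈ chartBall E N r ∧ chartNorm E g ≤ C * ϱ 1 g ^ s := by
  have : IsTopologicalGroup N := topologicalGroup_of_lieGroup 𝓘(ℝ, E) ∞
  obtain ⟨t₀, ht₀, hexp⟩ := exists_norm_exp_neg_smul_lt
    (LinearMap.toContinuousLinearMap (show E →ₗ[ℝ] E from α.toLinearMap)) (s := s)
    hα.splits hs
  set T : N →* N := (τ (Multiplicative.ofAdd (-t₀))).toMonoidHom with hT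
  have hTs : ContMDiff 𝓘(ℝ, E) 𝓘(ℝ, E) ∞ T := hτ.smooth (-t₀)
  have hTd : (mfderiv 𝓘(ℝ, E) 𝓘(ℝ, E) T (1 : N) : E →L[ℝ] E) = _ :=
    (hτ.mfderiv_one (-t₀)).trans (lieAlgebraExp_smul _ _)
  have hcontr := eventually_chartNorm_map_le T hTs hTd hexp
  set q := Real.exp (-t₀) with hq
  have hq1 : q < 1 := by rw [hq, Real.exp_lt_one_iff]; linarith
  have hq0 : 0 < q := Real.exp_pos _
  have hqs : Real.exp (-t₀ * s) = q ^ s := by rw [hq, Real.exp_mul]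
  have hqs1 : q ^ s < 1 := Real.rpow_lt_one hq0.le hq1 hs0
  have hqs0 : 0 < q ^ s := Real.rpow_pos_of_pos hq0 _
  rw [hqs] at hcontr
  obtain ⟨r₁, hr₁, hsub₁⟩ := exists_chartBall_subset (E := E) (inter_mem hcontr hU)
  obtain ⟨r₂, hr₂, K, hK, hsub₂⟩ := exists_isCompact_chartBall_subset (E := E) (N := N)
  -- `r₁` keeps the ball inside `U` and where `T` contracts; `r₂` keeps it inside a compact set.
  set r := min r₁ r₂ with hr
  have hr0 : 0 < r := lt_min hr₁ hr₂
  have hVc : ∀ g ∈ chartBall E N r, T g ∈ chartBall E N r ∧ chartNorm E (T g) ≤ q ^ s * chartNorm E g := by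
    intro g hg
    obtain ⟨h1, h2⟩ := (hsub₁ (chartBall_mono (min_le_left _ _) hg)).1
    refine ⟨⟨h1, h2.trans_lt (lt_of_le_of_lt ?_ hg.2)⟩, h2⟩
    exact mul_le_of_le_one_left (chartNorm_nonneg g) hqs1.le
  have hiter : ∀ (n : ℕ), ∀ g ∈ chartBall E N r,
      T^[n] g ∈ chartBall E N r ∧ chartNorm E (T^[n] g) ≤ (q ^ s) ^ n * chartNorm E g := by
    intro n
    induction n with
    | zero => intro g hg; simpa using hg
    | succ n ih =>
      intro g hg
      rw [Function.iterate_succ_apply']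
      obtain ⟨h1, h2⟩ := ih g hg
      obtain ⟨h3, h4⟩ := hVc _ h1
      refine ⟨h3, h4.trans ?_⟩
      rw [pow_succ', mul_assoc]
      gcongr
  have hT1 : ∀ g, Tendsto (fun n : ℕ => T^[n] g) atTop (𝓝 1) := by
    refine tendsto_iterate_of_eventually T ?_
    filter_upwards [(isOpen_chartBall (E := E) r).mem_nhds (one_mem_chartBall hr0)] with g hg
    intro W hW
    obtain ⟨r', hr', hsub'⟩ := exists_chartBall_subset (E := E) hW
    have hlim : Tendsto (fun n : ℕ => (q ^ s) ^ n * chartNorm E g) atTop (𝓝 0) := by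
      simpa using (tendsto_pow_atTop_nhds_zero_of_lt_one hqs0.le hqs1).mul_const (chartNorm E g)
    change ∀ᶠ n in atTop, T^[n] g ∈ W
    filter_upwards [hlim.eventually_lt_const hr'] with n hn
    obtain ⟨h1, h2⟩ := hiter n g hg
    exact hsub' ⟨h1.1, h2.trans_lt hn⟩
  have hinv : ∀ g, τ (Multiplicative.ofAdd t₀) (τ (Multiplicative.ofAdd (-t₀)) g) = g := fun g => by
    rw [← MulAut.mul_apply, ← map_mul, ← ofAdd_add]; simp
  have hinv' : ∀ g, τ (Multiplicative.ofAdd (-t₀)) (τ (Multiplicative.ofAdd t₀) g) = g := fun g => by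
    rw [← MulAut.mul_apply, ← map_mul, ← ofAdd_add]; simp
  let Th : N ≃ₜ N :=
    { toFun := T
      invFun := τ (Multiplicative.ofAdd t₀)
      left_inv := hinv
      right_inv := hinv'
      continuous_toFun := hTs.continuous
      continuous_invFun := (hτ.smooth t₀).continuous }
  have hρT : ∀ g, ϱ 1 (T g) = q * ϱ 1 g := fun g => hϱ.rho_one_map (-t₀) g
  have hρ : Continuous (fun g => ϱ 1 g) := hϱ.continuous.comp (by fun_prop : Continuous (fun g : N => ((1 : N), g)))
  obtain ⟨m, hm, hmV⟩ := exists_forall_le_imp_mem Th hT1 hρ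
    (fun g hg => (hϱ.nonneg 1 g).lt_of_ne fun h => hg ((hϱ.eq_zero_iff 1 g).1 h.symm).symm)
    (fun g => (hρT g).trans_le (mul_le_of_le_one_left (hϱ.nonneg 1 g) hq1.le))
    (isOpen_chartBall r) (one_mem_chartBall hr0) hK
    ((chartBall_mono (min_le_right _ _)).trans hsub₂)
  obtain ⟨C, hC, hCb⟩ := exists_le_mul_rpow_of_contraction Th.toEquiv (ρ := fun g => ϱ 1 g)
    (h := chartNorm E) hq0 hq1 hs0 hm hr0 (fun g => hϱ.nonneg 1 g) hρT
    (fun g hg => by rw [← (hϱ.eq_zero_iff 1 g).1 hg, chartNorm_one])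
    (fun g hg => (hmV g hg).2.le) (fun g hg => (hVc g (hmV g hg)).2)
  exact ⟨r, hr0, m, hm, C, hC, fun g hg => (hsub₁ (chartBall_mono (min_le_left _ _) hg)).2,
    fun g hg => ⟨hmV g hg, hCb g hg⟩⟩

open Classical in
/-- The chart distance to the identity, truncated at `r`. -/
def truncatedChartNorm (E : Type*) [NormedAddCommGroup E] [NormedSpace ℝ E]
    {N : Type*} [TopologicalSpace N] [ChartedSpace E N] [Group N] (r : ℝ) (g : N) : ℝ :=
  if g ∈ (extChartAt 𝓘(ℝ, E) (1 : N)).source then min (chartNorm E g) r else r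

/-- There is a function that vanishes exactly at the identity and is locally `s`-Hölder for `ϱ`. -/
theorem exists_holder_function [ConnectedSpace N]
    (α : LieDerivation ℝ (GroupLieAlgebra 𝓘(ℝ, E) N) (GroupLieAlgebra 𝓘(ℝ, E) N))
    (hα : IsPurelyRealHeintze α)
    (τ : Multiplicative ℝ →* MulAut N) (hτ : IsActionGeneratedBy τ α)
    (ϱ : N → N → ℝ) (hϱ : IsParabolicVisual τ ϱ) {s : ℝ} (hs0 : 0 < s)
    (hs : ∀ μ : ℝ, Module.End.HasEigenvalue α.toLinearMap μ → s < μ) :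
    ∃ f : N → ℝ, f 1 = 0 ∧ (∀ g, g ≠ 1 → 0 < f g) ∧ ∃ m > 0, ∃ C > 0,
      ∀ x y, ϱ x y < m → |f x - f y| ≤ C * ϱ x y ^ s := by
  obtain ⟨L, hL, U, hU, hlip⟩ := exists_norm_chart_mul_sub_le (E := E) (N := N)
  obtain ⟨r, hr, m, hm, C, hC, hrU, hb⟩ := exists_chartNorm_le α hα τ hτ ϱ hϱ hs0 hs hU
  have hone : truncatedChartNorm E r (1 : N) = 0 := by
    rw [truncatedChartNorm, if_pos (mem_extChartAt_source _), chartNorm_one, min_eq_left hr.le]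
  have hout : ∀ x, x ∉ chartBall E N r → truncatedChartNorm E r x = r := by
    intro x hx
    unfold truncatedChartNorm
    split_ifs with h
    · exact min_eq_right (not_lt.1 fun h' => hx ⟨h, h'⟩)
    · rfl
  -- The truncated norm is constant off the ball, so it suffices to treat pairs with one point in
  -- the ball. There `y = x * (x⁻¹ * y)`, with a second factor that is small by left invariance of
  -- `ϱ`.
  have hin : ∀ x ∈ chartBall E N r, ∀ y, ϱ x y < m →
      |truncatedChartNorm E r x - truncatedChartNorm E r y| ≤ L * C * ϱ x y ^ s := by
    intro x hx y hxy
    have h1 : ϱ 1 (x⁻¹ * y) = ϱ x y := by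
      have := hϱ.left_invariant x⁻¹ x y
      rwa [inv_mul_cancel] at this
    obtain ⟨hk, hkC⟩ := hb (x⁻¹ * y) (h1.trans_le hxy.le)
    obtain ⟨h2, h3⟩ := hlip x (hrU hx) _ (hrU hk)
    rw [mul_inv_cancel_left] at h2 h3
    rw [h1] at hkC
    rw [truncatedChartNorm, truncatedChartNorm, if_pos hx.1, if_pos h2]
    calc |min (chartNorm E x) r - min (chartNorm E y) r|
        ≤ |chartNorm E x - chartNorm E y| := by
          refine (abs_min_sub_min_le_max _ _ _ _).trans ?_
          simp
      _ ≤ ‖extChartAt 𝓘(ℝ, E) (1 : N) x - extChartAt 𝓘(ℝ, E) (1 : N) y‖ := by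
          refine (abs_norm_sub_norm_le _ _).trans_eq ?_
          rw [sub_sub_sub_cancel_right]
      _ ≤ L * chartNorm E (x⁻¹ * y) := by rwa [norm_sub_rev]
      _ ≤ L * (C * ϱ x y ^ s) := by gcongr
      _ = _ := by ring
  refine ⟨truncatedChartNorm E r, hone, fun g hg => ?_, m, hm, L * C, by positivity,
    fun x y hxy => ?_⟩
  · unfold truncatedChartNorm
    split_ifs with h
    · exact lt_min (chartNorm_pos h hg) hr
    · exact hr
  · by_cases hx : x ∈ chartBall E N r
    · exact hin x hx y hxy
    · by_cases hy : y ∈ chartBall E N r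
      · rw [abs_sub_comm, hϱ.symm x y]
        exact hin y hy x (by rwa [hϱ.symm y x])
      · rw [hout x hx, hout y hy, sub_self, abs_zero]
        have := hϱ.nonneg x y
        positivity

/-- A non-degenerate connected set has infinite `t`-dimensional Hausdorff measure if `t` is
smaller than all eigenvalues of `α`. -/
theorem qHausdorffMeasure_eq_top_of_isConnected [ConnectedSpace N]
    (α : LieDerivation ℝ (GroupLieAlgebra 𝓘(ℝ, E) N) (GroupLieAlgebra 𝓘(ℝ, E) N))
    (hα : IsPurelyRealHeintze α)
    (τ : Multiplicative ℝ →* MulAut N) (hτ : IsActionGeneratedBy τ α)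
    (ϱ : N → N → ℝ) (hϱ : IsParabolicVisual τ ϱ) {s : ℝ} {t : ℝ≥0} (hts : t < s)
    (hs : ∀ μ : ℝ, Module.End.HasEigenvalue α.toLinearMap μ → s < μ)
    {A : Set N} (hA : IsConnected A) (hA' : A.Nontrivial) : qHausdorffMeasure ϱ t A = ⊤ := by
  have hs0 : 0 < s := t.2.trans_lt hts
  obtain ⟨f, hf1, hfpos, m, hm, C, hC, hf⟩ := exists_holder_function α hα τ hτ ϱ hϱ hs0 hs
  obtain ⟨x, hx, y, hy, hxy⟩ := hA'
  have hF : ∀ a b, ϱ a b < m → |f (x⁻¹ * a) - f (x⁻¹ * b)| ≤ C * ϱ a b ^ s := by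
    intro a b hab
    have := hf (x⁻¹ * a) (x⁻¹ * b)
    rw [hϱ.left_invariant] at this
    exact this hab
  refine qHausdorffMeasure_eq_top_of_holder (f := fun a => f (x⁻¹ * a)) hm hC hts hF hϱ.nonneg ?_
  -- The Hölder bound gives continuity in the manifold topology because `ϱ` is continuous for it.
  have hcont : Continuous (fun a => f (x⁻¹ * a)) := by
    rw [continuous_iff_continuousAt]
    intro a
    have h1 : Tendsto (fun b => ϱ b a) (𝓝 a) (𝓝 0) := by
      have : Continuous (fun b => ϱ b a) := hϱ.continuous.comp (by fun_prop : Continuous (fun b : N => (b, a)))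
      simpa [(hϱ.eq_zero_iff a a).2 rfl] using this.tendsto a
    have h2 : Tendsto (fun b => C * ϱ b a ^ s) (𝓝 a) (𝓝 0) := by
      have := ((Real.continuousAt_rpow_const 0 s (Or.inr hs0.le)).tendsto.comp h1).const_mul C
      simpa [Real.zero_rpow hs0.ne'] using this
    refine tendsto_iff_dist_tendsto_zero.2 (squeeze_zero' (Eventually.of_forall fun _ => dist_nonneg)
      ?_ h2)
    filter_upwards [h1.eventually_lt_const hm] with b hb
    exact hF b a hb
  -- By connectedness the image contains the interval from `0` to `f (x⁻¹ * y) > 0`.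
  have hsub := hA.isPreconnected.intermediate_value hx hy hcont.continuousOn
  simp only [inv_mul_cancel, hf1] at hsub
  have hpos : 0 < f (x⁻¹ * y) := hfpos _ fun h => hxy (by rwa [inv_mul_eq_one] at h)
  intro h0
  have := MeasureTheory.measure_mono_null hsub h0
  rw [Real.volume_Icc, ENNReal.ofReal_eq_zero] at this
  linarith

end LowerBound
end

/-! ### Invariant vector fields under translations and automorphisms. -/

noncomputable section

open Filter Topology

section UpperBound

variable {E : Type*} [NormedAddCommGroup E] [NormedSpace ℝ E]

theorem exp_apply_of_apply_eq_smul [CompleteSpace E] (B : E →L[ℝ] E) {μ : ℝ} {v : E}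
    (hv : B v = μ • v) : NormedSpace.exp B v = Real.exp μ • v := by
  have hpow : ∀ n : ℕ, (B ^ n) v = μ ^ n • v := by
    intro n
    induction n with
    | zero => simp
    | succ n ih => rw [pow_succ, mul_apply_eq_comp, hv, map_smul, ih, smul_smul, pow_succ']
  have h1 := (NormedSpace.exp_series_hasSum_exp' (𝕂 := ℝ) B).mapL
    (ContinuousLinearMap.apply ℝ E v)
  have h2 : HasSum (fun n : ℕ => ((n.factorial : ℝ)⁻¹ • μ ^ n) • v) (Real.exp μ • v) := by
    rw [Real.exp_eq_exp_ℝ]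
    exact (NormedSpace.exp_series_hasSum_exp' (𝕂 := ℝ) μ).smul_const v
  have h3 : (fun n : ℕ => ContinuousLinearMap.apply ℝ E v ((n.factorial : ℝ)⁻¹ • B ^ n)) =
      fun n : ℕ => ((n.factorial : ℝ)⁻¹ • μ ^ n) • v := by
    funext n
    rw [ContinuousLinearMap.apply_apply, smul_apply, hpow, smul_smul, smul_eq_mul]
  rw [h3] at h1
  exact h1.unique h2

variable {N : Type*} [TopologicalSpace N] [ChartedSpace E N] [Group N] [LieGroup 𝓘(ℝ, E) ∞ N]

theorem hasMFDerivAt_mul_left (g h : N) :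
    HasMFDerivAt 𝓘(ℝ, E) 𝓘(ℝ, E) (g * ·) h (mfderiv 𝓘(ℝ, E) 𝓘(ℝ, E) (g * ·) h) :=
  ((contMDiff_mul_left (I := 𝓘(ℝ, E)) (n := ∞) (a := g)).mdifferentiable (by simp) h).hasMFDerivAt

theorem mfderiv_mul_left_mulInvariantVectorField (X : GroupLieAlgebra 𝓘(ℝ, E) N) (g h : N) :
    mfderiv 𝓘(ℝ, E) 𝓘(ℝ, E) (g * ·) h (mulInvariantVectorField X h) =
      mulInvariantVectorField X (g * h) := by
  -- The base point is written `h * 1` to match the chain rule for `(g * ·) ∘ (h * ·)` at `1`.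
  have h1 : HasMFDerivAt 𝓘(ℝ, E) 𝓘(ℝ, E) (g * ·) (h * 1)
      (mfderiv 𝓘(ℝ, E) 𝓘(ℝ, E) (g * ·) h : E →L[ℝ] E) := by
    rw [mul_one]; exact hasMFDerivAt_mul_left g h
  have h2 := (h1.comp (1 : N) (hasMFDerivAt_mul_left (E := E) h (1 : N))).mfderiv
  have h3 : (g * ·) ∘ (h * ·) = (g * h * ·) := by ext x; simp [mul_assoc]
  rw [h3] at h2
  simp only [mulInvariantVectorField]
  rw [h2]
  rfl

/-- If `X` is an eigenvector of the differential of an automorphism, then the automorphism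
multiplies the corresponding invariant vector field by the eigenvalue. -/
theorem mfderiv_hom_mulInvariantVectorField (T : N →* N) (hT : ContMDiff 𝓘(ℝ, E) 𝓘(ℝ, E) ∞ T)
    (X : GroupLieAlgebra 𝓘(ℝ, E) N) {a : ℝ}
    (hX : (mfderiv 𝓘(ℝ, E) 𝓘(ℝ, E) T (1 : N) : E →L[ℝ] E) X = (a • X : GroupLieAlgebra 𝓘(ℝ, E) N)) (h : N) :
    (mfderiv 𝓘(ℝ, E) 𝓘(ℝ, E) T h : E →L[ℝ] E) (mulInvariantVectorField X h) =
      a • (mulInvariantVectorField X (T h) : E) := by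
  have hTd : ∀ p, HasMFDerivAt 𝓘(ℝ, E) 𝓘(ℝ, E) T p (mfderiv 𝓘(ℝ, E) 𝓘(ℝ, E) T p) :=
    fun p => (hT.mdifferentiable (by simp) p).hasMFDerivAt
  have h1 : HasMFDerivAt 𝓘(ℝ, E) 𝓘(ℝ, E) T (h * 1)
      (mfderiv 𝓘(ℝ, E) 𝓘(ℝ, E) T h : E →L[ℝ] E) := by
    rw [mul_one]; exact hTd h
  have h2 := h1.comp (1 : N) (hasMFDerivAt_mul_left (E := E) h (1 : N))
  have h3 : HasMFDerivAt 𝓘(ℝ, E) 𝓘(ℝ, E) (T h * ·) (T 1)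
      (mfderiv 𝓘(ℝ, E) 𝓘(ℝ, E) (T h * ·) (1 : N) : E →L[ℝ] E) := by
    rw [map_one]; exact hasMFDerivAt_mul_left (T h) 1
  have h4 := h3.comp (1 : N) (hTd 1)
  -- Both sides of this identity are differentiated at `1`.
  have h5 : T ∘ (h * ·) = (T h * ·) ∘ T := by ext x; simp
  rw [h5] at h2
  have h6 := hasMFDerivAt_unique h2 h4
  have h7 := congrArg (fun L : E →L[ℝ] E => L X) h6
  have h8 : (mfderiv 𝓘(ℝ, E) 𝓘(ℝ, E) (T h * ·) (1 : N) : E →L[ℝ] E)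
      ((mfderiv 𝓘(ℝ, E) 𝓘(ℝ, E) T (1 : N) : E →L[ℝ] E) X) =
      a • (mulInvariantVectorField X (T h) : E) :=
    (congrArg _ hX).trans
      ((mfderiv 𝓘(ℝ, E) 𝓘(ℝ, E) (T h * ·) (1 : N) : E →L[ℝ] E).map_smul a X)
  exact Eq.trans h7 h8

theorem isMIntegralCurveOn_mul_left {X : GroupLieAlgebra 𝓘(ℝ, E) N} {γ : ℝ → N} {s : Set ℝ}
    (hγ : IsMIntegralCurveOn (I := 𝓘(ℝ, E)) γ (mulInvariantVectorField X) s) (g : N) :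
    IsMIntegralCurveOn (I := 𝓘(ℝ, E)) (fun x => g * γ x) (mulInvariantVectorField X) s := by
  intro x hx
  have h1 := (hasMFDerivAt_mul_left (E := E) g (γ x)).comp_hasMFDerivWithinAt x (hγ x hx)
  refine h1.congr_mfderiv (ContinuousLinearMap.ext_ring ?_)
  refine (congrArg _ (one_smul ℝ _)).trans
    ((mfderiv_mul_left_mulInvariantVectorField X g (γ x)).trans (one_smul ℝ _).symm)

theorem isMIntegralCurveOn_hom (T : N →* N) (hT : ContMDiff 𝓘(ℝ, E) 𝓘(ℝ, E) ∞ T)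
    {X : GroupLieAlgebra 𝓘(ℝ, E) N} {a : ℝ}
    (hX : (mfderiv 𝓘(ℝ, E) 𝓘(ℝ, E) T (1 : N) : E →L[ℝ] E) X = (a • X : GroupLieAlgebra 𝓘(ℝ, E) N))
    {γ : ℝ → N} {s : Set ℝ}
    (hγ : IsMIntegralCurveOn (I := 𝓘(ℝ, E)) γ (mulInvariantVectorField X) s) :
    IsMIntegralCurveOn (I := 𝓘(ℝ, E)) (T ∘ γ) (a • mulInvariantVectorField X) s := by
  intro x hx
  have h1 := (hT.mdifferentiable (by simp) (γ x)).hasMFDerivAt.comp_hasMFDerivWithinAt x (hγ x hx)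
  refine h1.congr_mfderiv (ContinuousLinearMap.ext_ring ?_)
  refine (congrArg _ (one_smul ℝ _)).trans
    ((mfderiv_hom_mulInvariantVectorField T hT X hX (γ x)).trans (one_smul ℝ _).symm)

end UpperBound
end

/-! ### Local one-parameter subgroups. -/

noncomputable section

open Filter Topology

section Curve

variable {E : Type*} [NormedAddCommGroup E] [NormedSpace ℝ E]
  {N : Type*} [TopologicalSpace N] [ChartedSpace E N] [Group N]

/-- Otherwise the velocity at `u / 2` would be both `X` and `0`. This makes the arc in the upper
bound non-degenerate. -/
theorem not_eqOn_one_of_isMIntegralCurveOn {X : GroupLieAlgebra 𝓘(ℝ, E) N} {γ : ℝ → N} {ε u : ℝ}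
    (hγ : IsMIntegralCurveOn (I := 𝓘(ℝ, E)) γ (mulInvariantVectorField X) (Set.Ioo (-ε) ε))
    (hX : X ≠ 0) (hu : 0 < u) (huε : u < ε) : ¬ ∀ a ∈ Set.Icc 0 u, γ a = 1 := by
  intro h
  have h1 := (hγ (u / 2) ⟨by linarith, by linarith⟩).hasMFDerivAt
    (Ioo_mem_nhds (by linarith) (by linarith))
  have h2 : γ =ᶠ[𝓝 (u / 2)] fun _ => 1 := by
    filter_upwards [Icc_mem_nhds (show 0 < u / 2 by linarith) (show u / 2 < u by linarith)] with a ha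
    exact h a ha
  have h3 := hasMFDerivAt_unique h1 ((hasMFDerivAt_const (1 : N) (u / 2)).congr_of_eventuallyEq h2)
  have h4 := congrArg (fun L : ℝ →L[ℝ] E => L 1) h3
  have h5 : (mulInvariantVectorField X (γ (u / 2)) : E) = 0 := (one_smul ℝ _).symm.trans h4
  rw [h (u / 2) ⟨by linarith, by linarith⟩] at h5
  have h6 : mulInvariantVectorField X (1 : N) = X := by
    have h7 : ((1 : N) * ·) = (id : N → N) := by ext; simp
    rw [mulInvariantVectorField, h7, mfderiv_id]
    rfl
  exact hX (h6.symm.trans h5)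

variable [LieGroup 𝓘(ℝ, E) ∞ N]

theorem contMDiff_one_mulInvariantVectorField (X : GroupLieAlgebra 𝓘(ℝ, E) N) :
    ContMDiff 𝓘(ℝ, E) 𝓘(ℝ, E).tangent 1
      (fun g : N => (⟨g, mulInvariantVectorField X g⟩ : TangentBundle 𝓘(ℝ, E) N)) :=
  (contMDiff_mulInvariantVectorField (I := 𝓘(ℝ, E)) X).of_le
    (le_trans (by norm_num) le_minSmoothness)

/-- There is a local one-parameter subgroup with given velocity. -/
theorem exists_isMIntegralCurveOn_mulInvariantVectorField [CompleteSpace E]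
    (X : GroupLieAlgebra 𝓘(ℝ, E) N) :
    ∃ γ : ℝ → N, γ 0 = 1 ∧ ∃ ε > 0,
      IsMIntegralCurveOn (I := 𝓘(ℝ, E)) γ (mulInvariantVectorField X) (Set.Ioo (-ε) ε) := by
  have : IsManifold 𝓘(ℝ, E) 1 N := IsManifold.of_le (n := ∞) (by simp)
  obtain ⟨γ, hγ0, hγ⟩ := exists_isMIntegralCurveAt_of_contMDiffAt_boundaryless (t₀ := 0)
    ((contMDiff_one_mulInvariantVectorField X).contMDiffAt (x := 1))
  obtain ⟨ε, hε, h⟩ := isMIntegralCurveAt_iff'.1 hγ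
  rw [Real.ball_eq_Ioo, zero_sub, zero_add] at h
  exact ⟨γ, hγ0, ε, hε, h⟩

variable [T2Space N]

theorem eqOn_of_isMIntegralCurveOn_mulInvariantVectorField {X : GroupLieAlgebra 𝓘(ℝ, E) N}
    {γ γ' : ℝ → N} {ε : ℝ} (hε : 0 < ε)
    (hγ : IsMIntegralCurveOn (I := 𝓘(ℝ, E)) γ (mulInvariantVectorField X) (Set.Ioo (-ε) ε))
    (hγ' : IsMIntegralCurveOn (I := 𝓘(ℝ, E)) γ' (mulInvariantVectorField X) (Set.Ioo (-ε) ε))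
    (h : γ 0 = γ' 0) : Set.EqOn γ γ' (Set.Ioo (-ε) ε) := by
  have : IsManifold 𝓘(ℝ, E) 1 N := IsManifold.of_le (n := ∞) (by simp)
  exact isMIntegralCurveOn_Ioo_eqOn_of_contMDiff_boundaryless (t₀ := 0) ⟨by linarith, hε⟩
    (contMDiff_one_mulInvariantVectorField X) hγ hγ' h

/-- Both sides, as functions of `b`, are integral curves of the same left-invariant field and agree
at `b = 0`. The bounds `ε / 2` keep `a + b` in the domain. -/
theorem map_add_of_isMIntegralCurveOn {X : GroupLieAlgebra 𝓘(ℝ, E) N} {γ : ℝ → N} {ε : ℝ}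
    (hγ0 : γ 0 = 1)
    (hγ : IsMIntegralCurveOn (I := 𝓘(ℝ, E)) γ (mulInvariantVectorField X) (Set.Ioo (-ε) ε))
    {a b : ℝ} (ha : |a| < ε / 2) (hb : |b| < ε / 2) : γ (a + b) = γ a * γ b := by
  have hε : 0 < ε / 2 := (abs_nonneg a).trans_lt ha
  rw [abs_lt] at ha hb
  have h1 : IsMIntegralCurveOn (I := 𝓘(ℝ, E)) (γ ∘ (· + a)) (mulInvariantVectorField X)
      (Set.Ioo (-(ε / 2)) (ε / 2)) :=
    (hγ.comp_add a).mono fun x hx => ⟨by linarith [hx.1], by linarith [hx.2]⟩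
  have h2 : IsMIntegralCurveOn (I := 𝓘(ℝ, E)) (fun x => γ a * γ x) (mulInvariantVectorField X)
      (Set.Ioo (-(ε / 2)) (ε / 2)) :=
    (isMIntegralCurveOn_mul_left hγ (γ a)).mono fun x hx => ⟨by linarith [hx.1], by linarith [hx.2]⟩
  have := eqOn_of_isMIntegralCurveOn_mulInvariantVectorField hε h1 h2 (by simp [hγ0]) hb
  simpa [add_comm b a] using this

/-- `T ∘ γ` follows `a • X`; slowed down by `a⁻¹` it follows `X`, so uniqueness identifies it with
`γ` on `(-aε, aε)`, which lies in the domain of `γ` as `a ≤ 1`. -/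
theorem hom_apply_of_isMIntegralCurveOn {X : GroupLieAlgebra 𝓘(ℝ, E) N} {γ : ℝ → N} {ε : ℝ}
    (hγ0 : γ 0 = 1)
    (hγ : IsMIntegralCurveOn (I := 𝓘(ℝ, E)) γ (mulInvariantVectorField X) (Set.Ioo (-ε) ε))
    (T : N →* N) (hT : ContMDiff 𝓘(ℝ, E) 𝓘(ℝ, E) ∞ T) {a : ℝ} (ha0 : 0 < a) (ha1 : a ≤ 1)
    (hX : (mfderiv 𝓘(ℝ, E) 𝓘(ℝ, E) T (1 : N) : E →L[ℝ] E) X = (a • X : GroupLieAlgebra 𝓘(ℝ, E) N))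
    {b : ℝ} (hb : |b| < ε) : T (γ b) = γ (a * b) := by
  have hε : 0 < ε := (abs_nonneg b).trans_lt hb
  have h1 := (isMIntegralCurveOn_hom T hT hX hγ).comp_mul a⁻¹
  rw [smul_smul, inv_mul_cancel₀ ha0.ne', one_smul] at h1
  have hsub : ∀ x ∈ Set.Ioo (-(a * ε)) (a * ε), x * a⁻¹ ∈ Set.Ioo (-ε) ε := by
    intro x hx
    rw [← div_eq_mul_inv]
    exact ⟨by rw [lt_div_iff₀ ha0]; linarith [hx.1], by rw [div_lt_iff₀ ha0]; linarith [hx.2]⟩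
  have h2 := hγ.mono (s' := Set.Ioo (-(a * ε)) (a * ε)) fun x hx =>
    ⟨by nlinarith [hx.1], by nlinarith [hx.2]⟩
  have h3 := eqOn_of_isMIntegralCurveOn_mulInvariantVectorField (mul_pos ha0 hε) (h1.mono hsub) h2
    (by simp [hγ0])
  rw [abs_lt] at hb
  have h4 := h3 (x := a * b) ⟨by nlinarith, by nlinarith⟩
  simp only [Function.comp_apply] at h4
  rwa [mul_comm a b, mul_inv_cancel_right₀ ha0.ne', mul_comm b a] at h4

end Curve

/-! ### Upper bound: the arc of an eigenvector, and the conclusion. -/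

section UpperBound

variable {E : Type*} [NormedAddCommGroup E] [NormedSpace ℝ E] [FiniteDimensional ℝ E]
  {N : Type*} [TopologicalSpace N] [T2Space N] [ChartedSpace E N] [Group N]
  [LieGroup 𝓘(ℝ, E) ∞ N]

/-- The local one-parameter subgroup of an eigenvector for `lam` is a non-degenerate connected set
of dimension at most `lam`. -/
theorem exists_isConnected_qHdim_le
    (α : LieDerivation ℝ (GroupLieAlgebra 𝓘(ℝ, E) N) (GroupLieAlgebra 𝓘(ℝ, E) N))
    (τ : Multiplicative ℝ →* MulAut N) (hτ : IsActionGeneratedBy τ α)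
    (ϱ : N → N → ℝ) (hϱ : IsParabolicVisual τ ϱ) {lam : ℝ} (hlam0 : 0 < lam)
    (hlam : Module.End.HasEigenvalue α.toLinearMap lam) :
    ∃ A : Set N, IsConnected A ∧ A.Nontrivial ∧ qHdim ϱ A ≤ ENNReal.ofReal lam := by
  have : CompleteSpace E := FiniteDimensional.complete ℝ E
  obtain ⟨X, hX⟩ := hlam.exists_hasEigenvector
  have hαX : α.toLinearMap X = lam • X := hX.apply_eq_smul
  have hTX : ∀ t : ℝ, (mfderiv 𝓘(ℝ, E) 𝓘(ℝ, E) (τ (Multiplicative.ofAdd t)).toMonoidHom (1 : N) :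
      E →L[ℝ] E) X = (Real.exp (t * lam) • X : GroupLieAlgebra 𝓘(ℝ, E) N) := by
    intro t
    have h1 := (hτ.mfderiv_one t).trans (lieAlgebraExp_smul _ _)
    have h2 : (t • LinearMap.toContinuousLinearMap (show E →ₗ[ℝ] E from α.toLinearMap)) X =
        ((t * lam) • X : GroupLieAlgebra 𝓘(ℝ, E) N) :=
      (congrArg (fun Y : GroupLieAlgebra 𝓘(ℝ, E) N => t • Y) hαX).trans (smul_smul _ _ _)
    exact (congrArg (fun L : E →L[ℝ] E => L X) h1).trans (exp_apply_of_apply_eq_smul _ h2)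
  obtain ⟨γ, hγ0, ε, hε, hγ⟩ := exists_isMIntegralCurveOn_mulInvariantVectorField X
  -- Parameters in `[0, u]` and their differences stay below `ε / 2`, as the additivity of `γ`
  -- requires.
  set u := ε / 4 with hu
  have hu0 : 0 < u := by positivity
  set D := ϱ 1 (γ u) with hD
  have hD0 : 0 ≤ D := hϱ.nonneg _ _
  have hone : ∀ w ∈ Set.Icc 0 u, ϱ 1 (γ w) ≤ D * (w / u) ^ (1 / lam) := by
    intro w hw
    rcases hw.1.eq_or_lt with rfl | hw0
    · rw [hγ0, (hϱ.eq_zero_iff 1 1).2 rfl]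
      positivity
    · have hwu : 0 < w / u := by positivity
      -- Chosen so that `τ(t)` carries `γ u` to `γ w`; then `e^t = (w / u) ^ (1 / lam)` is the
      -- factor on `ϱ`.
      set t := Real.log (w / u) / lam with ht
      have hexp : Real.exp (t * lam) = w / u := by
        rw [ht, div_mul_cancel₀ _ hlam0.ne', Real.exp_log hwu]
      have hT := hTX t
      rw [hexp] at hT
      have h1 := hom_apply_of_isMIntegralCurveOn hγ0 hγ (τ (Multiplicative.ofAdd t)).toMonoidHom
        (hτ.smooth t) hwu ((div_le_one hu0).2 hw.2) hT (b := u)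
        (by rw [abs_of_pos hu0]; linarith)
      rw [div_mul_cancel₀ _ hu0.ne'] at h1
      rw [← h1]
      refine (hϱ.rho_one_map t (γ u)).le.trans_eq ?_
      rw [Real.rpow_def_of_pos hwu, mul_comm D, ht, mul_one_div]
  have hhol : ∀ a ∈ Set.Icc 0 u, ∀ b ∈ Set.Icc 0 u, a ≤ b →
      ϱ (γ a) (γ b) ≤ D * (1 / u) ^ (1 / lam) * |a - b| ^ (1 / lam) := by
    intro a ha b hb hab
    have h1 : γ b = γ a * γ (b - a) := by
      rw [← map_add_of_isMIntegralCurveOn hγ0 hγ, add_sub_cancel]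
      · rw [abs_of_nonneg ha.1]; linarith [ha.2]
      · rw [abs_of_nonneg (sub_nonneg.2 hab)]; linarith [ha.1, hb.2]
    have h2 := hϱ.left_invariant (γ a) 1 (γ (b - a))
    rw [mul_one, ← h1] at h2
    rw [h2]
    refine (hone (b - a) ⟨sub_nonneg.2 hab, by linarith [ha.1, hb.2]⟩).trans_eq ?_
    rw [abs_sub_comm, abs_of_nonneg (sub_nonneg.2 hab), mul_assoc,
      ← Real.mul_rpow (by positivity) (sub_nonneg.2 hab), one_div_mul_eq_div]
  have hcont : ContinuousOn γ (Set.Icc 0 u) := fun a ha =>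
    ((hγ a ⟨by linarith [ha.1], by linarith [ha.2]⟩).continuousWithinAt.mono
      fun x hx => ⟨by linarith [hx.1], by linarith [hx.2]⟩)
  refine ⟨γ '' Set.Icc 0 u, (isConnected_Icc hu0.le).image _ hcont, ?_,
    qHdim_image_Icc_le hu0 hlam0 (C := D * (1 / u) ^ (1 / lam)) (by positivity) ?_⟩
  -- If `γ u = 1` then `D = 0`, and `hone` collapses the whole arc to `1`.
  · refine ⟨1, ⟨0, ⟨le_rfl, hu0.le⟩, hγ0⟩, γ u, ⟨u, ⟨hu0.le, le_rfl⟩, rfl⟩, fun h => ?_⟩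
    refine not_eqOn_one_of_isMIntegralCurveOn hγ hX.2 hu0 (by linarith) fun a ha => ?_
    have h1 := hone a ha
    rw [hD, ← h, (hϱ.eq_zero_iff 1 1).2 rfl, zero_mul] at h1
    exact ((hϱ.eq_zero_iff _ _).1 (le_antisymm h1 (hϱ.nonneg _ _))).symm
  · intro a ha b hb
    rcases le_total a b with hab | hab
    · exact hhol a ha b hb hab
    · rw [hϱ.symm, abs_sub_comm]
      exact hhol b hb a ha hab

end UpperBound
end
theorem lemma5p1
    {E : Type*} [NormedAddCommGroup E] [NormedSpace ℝ E] [FiniteDimensional ℝ E]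
    {N : Type*} [TopologicalSpace N] [T2Space N] [ChartedSpace E N] [Group N]
    [LieGroup 𝓘(ℝ, E) ∞ N] [SimplyConnectedSpace N] [Group.IsNilpotent N]
    (α : LieDerivation ℝ (GroupLieAlgebra 𝓘(ℝ, E) N) (GroupLieAlgebra 𝓘(ℝ, E) N))
    (hα : IsPurelyRealHeintze α)
    (τ : Multiplicative ℝ →* MulAut N) (hτ : IsActionGeneratedBy τ α)
    (ϱ : N → N → ℝ) (hϱ : IsParabolicVisual τ ϱ)
    (lam : ℝ) (hlam : IsLeast {μ : ℝ | Module.End.HasEigenvalue α.toLinearMap μ} lam) :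
    minConnectedHdim ϱ = ENNReal.ofReal lam := by
  have hlam0 : 0 < lam := hα.pos lam hlam.1
  refine le_antisymm ?_ ?_
  · obtain ⟨A, hA, hA', hle⟩ := exists_isConnected_qHdim_le α τ hτ ϱ hϱ hlam0 hlam.1
    exact iInf_le_of_le A (iInf_le_of_le hA (iInf_le_of_le hA' hle))
  · refine le_iInf fun A => le_iInf fun hA => le_iInf fun hA' => ?_
    refine ENNReal.le_of_forall_nnreal_lt fun t ht => ?_
    have htl : (t : ℝ) < lam := by
      rw [← ENNReal.ofReal_coe_nnreal] at ht
      exact (ENNReal.ofReal_lt_ofReal_iff hlam0).1 ht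
    -- Both gaps matter: `t < s` for infinite measure, `s < lam` to absorb the polynomial growth of
    -- Jordan blocks.
    obtain ⟨s, hts, hsl⟩ := exists_between htl
    exact le_iSup₂_of_le t (qHausdorffMeasure_eq_top_of_isConnected α hα τ hτ ϱ hϱ hts
      (fun μ hμ => hsl.trans_le (hlam.2 hμ)) hA hA') le_rfl
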